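/- Let $a\in\mathbb C$ with $0<|a|<1$, and let $G(z)=az+F(z)$ be a meromorphic function on $\mathbb C$, where $F$ is analytic at $0$ and $F(0)=F'(0)=0$. Fix a value of $\ln a$. The equation $$x_{n+1}=G(x_n)=ax_n+F(x_n)\qquad(1)$$ is considered with its transseries solutions: a sequence of coefficients $(D_k)_{k\ge 1}$ gives a family of solutions of (1) if, for every $C\in\mathbb C$, the series $x_n(C)=\sum_{k\ge1}e^{nk\ln a}C^kD_k$ converges and $x_{n+1}(C)=G(x_n(C))$ for all sufficiently large $n$. The analyzable embedding of $x_n(C)$ is $x(z;C)=\sum_{k\ge1}e^{zk\ln a}C^kD_k$, which is analytic in some half-plane $\operatorname{Re}(z\ln a)<R$. (All its singularities in $\mathbb C$ are movable, because replacing $C$ by $Ce^{s\ln a}$ replaces $x(z;C)$ by $x(z+s;C)$.) The equation (1) has the isolated movable singularity property (IMSP) if, for all such families and all $C$, the singularities of $x(\cdot\,;C)$ in $\mathbb C$ are isolated, i.e. $x(\cdot\,;C)$ continues from such a half-plane to a single-valued analytic function on $\mathbb C\setminus S$ for some closed discrete set $S\subset\mathbb C$ (so branch points, accumulating poles and barriers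 of singularities are excluded). **Theorem.** The equation (1) has the IMSP if and only if, for some $c\in\mathbb C$, $$G(z)=\frac{az}{1+cz}.\qquad(2)$$ In particular, (1) fails to have the IMSP unless $G$ is of the form (2). In case (2) the equation is solved explicitly: let $N\in\mathbb N\cup\{\infty\}$ and let $(x_n)$ be a sequence of complex numbers with $x_0\ne0$. Then $1+cx_n\neq 0$ and $x_{n+1}=G(x_n)$ for all $n<N$ if and only if there is a constant $C\in\mathbb C$ such that, for all finite $n\le N$, $x_n\ne0$ and $$\frac1{x_n}=a^{-n}\Bigl(C-\frac{c}{a-1}\Bigr)+\frac{c}{a-1}.$$ -/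

import Mathlib

open Filter

noncomputable section

namespace DifferenceIMSP

/-- The `(k+1)`-st term `D_{k+1} C^{k+1} e^{(k+1) z L}` of the transseries
`∑_{k ≥ 1} e^{z k L} C^k D_k`. Here `L` is the chosen value of `ln a`; the entry `D 0` is unused. -/
def transTerm (L : ℂ) (D : ℕ → ℂ) (C z : ℂ) (k : ℕ) : ℂ :=
  Complex.exp (z * ((k + 1 : ℕ) : ℂ) * L) * C ^ (k + 1) * D (k + 1)

/-- `x(z; C) = ∑_{k ≥ 1} e^{z k L} C^k D_k`. At `z = n ∈ ℕ` this is the sequence `x_n(C)`; as a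
function of complex `z` it is the analyzable embedding of that sequence. -/
def embedding (L : ℂ) (D : ℕ → ℂ) (C z : ℂ) : ℂ :=
  ∑' k : ℕ, transTerm L D C z k

/-- The coefficients `D` (which do not depend on `C`) give a one-parameter family of transseries
solutions of `x_{n+1} = G (x_n)`: for every `C` the series for `x_n(C)` converges for all large `n`
and `x_{n+1}(C) = G (x_n(C))` for all large `n`. -/
def IsSolutionFamily (G : ℂ → ℂ) (L : ℂ) (D : ℕ → ℂ) : Prop :=
  ∀ C : ℂ, ∀ᶠ n : ℕ in atTop, Summable (transTerm L D C (n : ℂ)) ∧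
    embedding L D C ((n + 1 : ℕ) : ℂ) = G (embedding L D C (n : ℂ))

/-- The function `x`, given on a half-plane `Re (z L) < R` (where `e^{z L}` is small), has only
isolated singularities in `ℂ`: it continues to a single-valued analytic function off a closed
discrete set `S`. Branch points, clusters of poles (accumulating at a finite point) and
barriers of singularities are thereby excluded, isolated essential singularities are not. -/
def OnlyIsolatedSingularities (L : ℂ) (x : ℂ → ℂ) : Prop :=
  ∃ S : Set ℂ, IsClosed S ∧ IsDiscrete S ∧
    ∃ X : ℂ → ℂ, AnalyticOnNhd ℂ X Sᶜ ∧
      ∃ R : ℝ, ∀ z : ℂ, (z * L).re < R → z ∉ S ∧ X z = x z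

/-- Changing the parameter `C` to `C e^{s L}` translates the solution by `s`. Since every nonzero
factor is of the form `e^{s L}` when `L ≠ 0`, each singularity in `ℂ` of a solution moves when
`C` varies: every singularity is movable. -/
theorem embedding_shift (L : ℂ) (D : ℕ → ℂ) (C s z : ℂ) :
    embedding L D (C * Complex.exp (s * L)) z = embedding L D C (z + s) := by
  unfold embedding transTerm
  refine tsum_congr fun k => ?_
  have h : Complex.exp ((z + s) * ((k + 1 : ℕ) : ℂ) * L)
      = Complex.exp (z * ((k + 1 : ℕ) : ℂ) * L) * Complex.exp (s * L) ^ (k + 1) := by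
    rw [← Complex.exp_nat_mul, ← Complex.exp_add]
    congr 1
    ring
  rw [h, mul_pow]
  ring

/-- The isolated movable singularity property of the autonomous equation `x_{n+1} = G (x_n)` at
its fixed point `0` of multiplier `e^L`: the embedding `x(z; C)` of every transseries solution has
only isolated movable singularities. By `embedding_shift` all singularities in `ℂ` of these
functions are movable, so none is exempted. -/
def HasIMSP (G : ℂ → ℂ) (L : ℂ) : Prop :=
  ∀ D : ℕ → ℂ, IsSolutionFamily G L D →
    ∀ C : ℂ, OnlyIsolatedSingularities L (embedding L D C)

end DifferenceIMSP

end

namespace DifferenceIMSP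

open Topology Metric Set Asymptotics

/-! A solution family is a germ `φ` with `φ 0 = 0` and `φ (a w) = G (φ w)`, through `x(z; C) = φ (C
e^{zL})`.

Necessity. Let `φ` be tangent to the identity (the inverse of Koenigs' function) and let `X`
continue `φ (e^{zL})` off a closed discrete set `S`. The relation `X (z + 1) = G (X z)` persists. If
`X z = φ w` with `w` small, following the orbit until `e^{(z+n)L}` is small and using injectivity of
`φ` gives `w = e^{zL}`. Hence `X` stays away from `0` outside the half-plane where `e^{zL}` is
small, while inside it `1/φ w - 1/w` is bounded because `φ w = w + O(w²)`. So `1/X - e^{-zL}` is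
bounded off `S`, thus a constant `b` by Riemann and Liouville. Then `1/φ w = 1/w + b`, and `G`,
conjugate by `φ` to `w ↦ a w`, is Möbius (`linearization_moebius_of_continuation`).

Sufficiency. For Möbius `G` a Möbius coordinate makes `G` linear. In it every `φ` commutes with `w ↦
a w`, hence is linear (`eventually_eq_mul_of_comp_mul`), so `x(z; C)` is a Möbius function of
`e^{zL}`. -/

/-! ### Koenigs linearization at the attracting fixed point. -/

/-- An analytic function that vanishes to second order at `0` is `O(‖y‖ ^ 2)` there. -/
lemma isBigO_norm_sq_of_deriv_eq_zero {f : ℂ → ℂ} (hf : AnalyticAt ℂ f 0) (h0 : f 0 = 0)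
    (h1 : deriv f 0 = 0) : f =O[𝓝 0] fun y => ‖y‖ ^ 2 := by
  obtain ⟨p, hp⟩ := hf
  have h := hp.isBigO_sub_partialSum_pow 2
  refine h.congr_left fun y => ?_
  have e1 : p.coeff 1 = 0 := hp.deriv.symm.trans h1
  have e0 : p.coeff 0 = 0 := (hp.coeff_zero _).trans h0
  simp [FormalMultilinearSeries.partialSum, Finset.sum_range_succ, e0, e1]

/-- A function that agrees with the identity up to `O(‖y‖ ^ 2)` has derivative `1` at `0`. -/
lemma hasDerivAt_one_of_norm_sub_le_sq {f : ℂ → ℂ} {ε M : ℝ} (hε : 0 < ε) (h0 : f 0 = 0)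
    (h : ∀ y : ℂ, ‖y‖ < ε → ‖f y - y‖ ≤ M * ‖y‖ ^ 2) : HasDerivAt f 1 0 := by
  rw [hasDerivAt_iff_isLittleO]
  have hO : (fun y : ℂ => f y - f 0 - (y - 0) • (1 : ℂ)) =O[𝓝 0] fun y : ℂ => ‖y‖ ^ 2 := by
    refine IsBigO.of_bound M ?_
    filter_upwards [ball_mem_nhds (0 : ℂ) hε] with y hy
    simpa [h0] using h y (by simpa using hy)
  refine hO.trans_isLittleO ?_
  simpa using isLittleO_norm_pow_id (E' := ℂ) one_lt_two

/-- Koenigs' linearization: a germ with attracting multiplier `a ≠ 0` is conjugated to its linear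
part by `ψ = lim a ^ (-n) G^n`. -/
theorem exists_koenigs {a : ℂ} {G : ℂ → ℂ} (hG : AnalyticAt ℂ G 0) (hG0 : G 0 = 0)
    (hG1 : deriv G 0 = a) (ha0 : 0 < ‖a‖) (ha1 : ‖a‖ < 1) :
    ∃ ψ : ℂ → ℂ, AnalyticAt ℂ ψ 0 ∧ ψ 0 = 0 ∧ deriv ψ 0 = 1 ∧
      ∀ᶠ y in 𝓝 0, ψ (G y) = a * ψ y := by
  have ha : a ≠ 0 := norm_pos_iff.1 ha0
  -- `b > ‖a‖` is a contraction rate for `G` near `0`; `b² < ‖a‖` lets the quadratic error, of size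
  -- `b^(2n)`, beat the division by `a^(n+1)`.
  obtain ⟨b, hab, hb⟩ : ∃ b, ‖a‖ < b ∧ b < √‖a‖ :=
    exists_between (Real.lt_sqrt_of_sq_lt (by nlinarith))
  have hb0 : 0 < b := ha0.trans hab
  have hb2 : b ^ 2 < ‖a‖ := (Real.lt_sqrt hb0.le).1 hb
  have hb1 : b < 1 := by nlinarith
  have hF : (fun y => G y - a * y) =O[𝓝 0] fun y : ℂ => ‖y‖ ^ 2 := by
    refine isBigO_norm_sq_of_deriv_eq_zero (by fun_prop) (by simp [hG0]) ?_
    have := (hG.differentiableAt.hasDerivAt.sub ((hasDerivAt_id (0 : ℂ)).const_mul a)).deriv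
    rw [hG1] at this
    exact this.trans (by simp)
  obtain ⟨K, hK0, hK⟩ := hF.exists_pos
  obtain ⟨ε₀, hε₀, hε⟩ := Metric.eventually_nhds_iff_ball.1
    (hK.bound.and hG.eventually_analyticAt)
  obtain ⟨ε, hεp, hε1, hε2⟩ : ∃ ε, 0 < ε ∧ ε ≤ ε₀ ∧ K * ε ≤ b - ‖a‖ := by
    refine ⟨min ε₀ ((b - ‖a‖) / K), lt_min hε₀ (div_pos (sub_pos.2 hab) hK0), min_le_left _ _, ?_⟩
    rw [mul_comm, ← le_div_iff₀ hK0]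
    exact min_le_right _ _
  have hquad : ∀ y : ℂ, ‖y‖ < ε → ‖G y - a * y‖ ≤ K * ‖y‖ ^ 2 := fun y hy => by
    simpa using (hε y (by simpa using hy.trans_le hε1)).1
  have hGd : ∀ y : ℂ, ‖y‖ < ε → DifferentiableAt ℂ G y := fun y hy =>
    (hε y (by simpa using hy.trans_le hε1)).2.differentiableAt
  have hcontr : ∀ y : ℂ, ‖y‖ < ε → ‖G y‖ ≤ b * ‖y‖ := fun y hy => by
    have h1 : ‖G y‖ ≤ ‖G y - a * y‖ + ‖a‖ * ‖y‖ := by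
      simpa using norm_add_le (G y - a * y) (a * y)
    have h2 := hquad y hy
    have h3 : K * ‖y‖ ≤ b - ‖a‖ := (mul_le_mul_of_nonneg_left hy.le hK0.le).trans hε2
    nlinarith [norm_nonneg y]
  have hiter : ∀ (n : ℕ) (y : ℂ), ‖y‖ < ε → ‖G^[n] y‖ ≤ b ^ n * ‖y‖ := by
    intro n y hy
    induction n with
    | zero => simp
    | succ n ih =>
      have h4 : ‖G^[n] y‖ < ε :=
        ih.trans_lt ((mul_le_of_le_one_left (norm_nonneg y) (pow_le_one₀ hb0.le hb1.le)).trans_lt hy)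
      rw [Function.iterate_succ_apply', pow_succ', mul_assoc]
      exact (hcontr _ h4).trans (mul_le_mul_of_nonneg_left ih hb0.le)
  have hiter' : ∀ (n : ℕ) (y : ℂ), ‖y‖ < ε → ‖G^[n] y‖ < ε := fun n y hy =>
    (hiter n y hy).trans_lt
      ((mul_le_of_le_one_left (norm_nonneg y) (pow_le_one₀ hb0.le hb1.le)).trans_lt hy)
  have hiterd : ∀ n : ℕ, DifferentiableOn ℂ G^[n] (ball 0 ε) := by
    intro n
    induction n with
    | zero => exact differentiableOn_id
    | succ n ih =>
      rw [Function.iterate_succ']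
      intro y hy
      exact (hGd _ (hiter' n y (by simpa using hy))).comp_differentiableWithinAt y (ih y hy)
  -- The increments of `G^[n] y / a^n`, so that `ψ` below is a telescoping sum.
  let t : ℕ → ℂ → ℂ := fun n y => (G^[n + 1] y - a * G^[n] y) / a ^ (n + 1)
  have ht : ∀ (n : ℕ) (y : ℂ), ‖y‖ < ε → ‖t n y‖ ≤ K / ‖a‖ * ‖y‖ ^ 2 * (b ^ 2 / ‖a‖) ^ n := by
    intro n y hy
    have h1 := hquad _ (hiter' n y hy)
    have h2 : ‖G^[n] y‖ ^ 2 ≤ (b ^ n * ‖y‖) ^ 2 :=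
      pow_le_pow_left₀ (norm_nonneg _) (hiter n y hy) 2
    simp only [t, norm_div, norm_pow, Function.iterate_succ_apply']
    calc _ ≤ K * (b ^ n * ‖y‖) ^ 2 / ‖a‖ ^ (n + 1) := by gcongr; exact h1.trans (by gcongr)
      _ = _ := by rw [div_pow]; field_simp; ring
  have hgeo : Summable fun n : ℕ => (b ^ 2 / ‖a‖) ^ n :=
    summable_geometric_of_lt_one (by positivity) ((div_lt_one ha0).2 hb2)
  have hts : ∀ y : ℂ, ‖y‖ < ε → Summable fun n => t n y := fun y hy =>
    Summable.of_norm_bounded (hgeo.mul_left _) (ht · y hy)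
  let ψ : ℂ → ℂ := fun y => y + ∑' n, t n y
  have hψd : DifferentiableOn ℂ ψ (ball 0 ε) := by
    refine differentiableOn_id.add (Complex.differentiableOn_tsum_of_summable_norm
      (hgeo.mul_left (K / ‖a‖ * ε ^ 2)) (fun n => ?_) isOpen_ball fun n y hy => ?_)
    · exact ((hiterd (n + 1)).sub ((hiterd n).const_mul a)).div_const _
    · have hy' : ‖y‖ < ε := by simpa using hy
      refine (ht n y hy').trans ?_
      gcongr
  have hψ0 : ψ 0 = 0 := by
    have h : ∀ n, G^[n] 0 = 0 := fun n => Function.iterate_fixed hG0 n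
    simp [ψ, t, h, hG0]
  have hψlim : ∀ y : ℂ, ‖y‖ < ε →
      Tendsto (fun n => G^[n] y / a ^ n) atTop (𝓝 (ψ y)) := by
    intro y hy
    have h := ((hts y hy).hasSum.tendsto_sum_nat).const_add y
    refine h.congr fun n => ?_
    induction n with
    | zero => simp
    | succ n ih =>
      rw [Finset.sum_range_succ, ← add_assoc, ih]
      simp only [t]
      field_simp
      ring
  refine ⟨ψ, hψd.analyticAt (ball_mem_nhds 0 hεp), hψ0, ?_, ?_⟩
  · refine (hasDerivAt_one_of_norm_sub_le_sq (M := K / ‖a‖ * ∑' n : ℕ, (b ^ 2 / ‖a‖) ^ n)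
      hεp hψ0 fun y hy => ?_).deriv
    have h := tsum_of_norm_bounded (hgeo.mul_left (K / ‖a‖ * ‖y‖ ^ 2)).hasSum (ht · y hy)
    rw [tsum_mul_left] at h
    simp only [ψ, add_sub_cancel_left]
    exact h.trans_eq (by ring)
  · filter_upwards [ball_mem_nhds (0 : ℂ) hεp] with y hy
    have hy' : ‖y‖ < ε := by simpa using hy
    refine tendsto_nhds_unique (hψlim _ (hiter' 1 y hy')) ?_
    refine (((hψlim y hy').comp (tendsto_add_atTop_nat 1)).const_mul a).congr fun n => ?_
    simp only [Function.comp_apply, Function.iterate_succ_apply, pow_succ]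
    field_simp

/-- The inverse of Koenigs' function: `w ↦ φ w` conjugates `w ↦ a w` to `G`. -/
theorem exists_linearization {a : ℂ} {G : ℂ → ℂ} (hG : AnalyticAt ℂ G 0) (hG0 : G 0 = 0)
    (hG1 : deriv G 0 = a) (ha0 : 0 < ‖a‖) (ha1 : ‖a‖ < 1) :
    ∃ φ : ℂ → ℂ, AnalyticAt ℂ φ 0 ∧ φ 0 = 0 ∧ deriv φ 0 = 1 ∧
      ∀ᶠ w in 𝓝 0, φ (a * w) = G (φ w) := by
  obtain ⟨ψ, hψ, hψ0, hψ1, hconj⟩ := exists_koenigs hG hG0 hG1 ha0 ha1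
  have hne : deriv ψ 0 ≠ 0 := by rw [hψ1]; exact one_ne_zero
  let φ := hψ.hasStrictDerivAt.localInverse _ _ _ hne
  have hφ : AnalyticAt ℂ φ 0 := by simpa [hψ0] using hψ.analyticAt_localInverse hne
  have hleft : ∀ᶠ y in 𝓝 0, φ (ψ y) = y := hψ.hasStrictDerivAt.eventually_left_inverse hne
  have hright : ∀ᶠ w in 𝓝 0, ψ (φ w) = w := by
    simpa [hψ0] using hψ.hasStrictDerivAt.eventually_right_inverse hne
  have hφ0 : φ 0 = 0 := by simpa [hψ0] using hleft.self_of_nhds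
  have hφ1 : deriv φ 0 = 1 := by
    have h := (hψ.hasStrictDerivAt.to_localInverse hne).hasDerivAt.deriv
    simpa [hψ0, hψ1] using h
  have htφ : Tendsto φ (𝓝 0) (𝓝 0) := by simpa [hφ0] using hφ.continuousAt.tendsto
  have htG : Tendsto G (𝓝 0) (𝓝 0) := by simpa [hG0] using hG.continuousAt.tendsto
  refine ⟨φ, hφ, hφ0, hφ1, ?_⟩
  filter_upwards [htφ.eventually hconj, hright, (htG.comp htφ).eventually hleft] with w h1 h2 h3
  rw [← h2, ← h1, h2]
  exact h3

/-! ### Analytic continuation and rigidity of the linearization. -/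

/-- Riemann and Liouville: a bounded analytic function off a closed discrete set is constant. -/
theorem exists_eq_const_of_bounded_off_discrete {S : Set ℂ} (hS : IsClosed S) (hd : IsDiscrete S)
    {H : ℂ → ℂ} (hH : AnalyticOnNhd ℂ H Sᶜ) {M : ℝ} (hM : ∀ z ∉ S, ‖H z‖ ≤ M) :
    ∃ b, ∀ z ∉ S, H z = b := by
  have hpunct : ∀ p : ℂ, ∃ s ∈ 𝓝 p, s \ {p} ⊆ Sᶜ := by
    intro p
    have h := mem_codiscrete.1 (compl_mem_codiscrete_iff.2 ⟨hS, hd⟩) p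
    rw [disjoint_principal_right, compl_compl, mem_nhdsWithin_iff_exists_mem_nhds_inter] at h
    obtain ⟨s, hs, hsub⟩ := h
    exact ⟨s, hs, hsub⟩
  -- Filling in the removable singularities at all points of `S` at once.
  let E : ℂ → ℂ := fun p => limUnder (𝓝[≠] p) H
  have hE : ∀ z ∉ S, E z = H z := fun z hz =>
    ((hH z hz).continuousAt.tendsto.mono_left nhdsWithin_le_nhds).limUnder_eq
  have hEd : Differentiable ℂ E := by
    intro p
    obtain ⟨s, hs, hsub⟩ := hpunct p
    have h := Complex.differentiableOn_update_limUnder_of_bddAbove hs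
      (fun z hz => (hH z (hsub hz)).differentiableAt.differentiableWithinAt)
      ⟨M, by rintro _ ⟨z, hz, rfl⟩; exact hM z (hsub hz)⟩
    refine (h.differentiableAt hs).congr_of_eventuallyEq ?_
    filter_upwards [hs] with z hz
    by_cases hzp : z = p
    · subst hzp; simp [E]
    · rw [Function.update_of_ne hzp, hE z (hsub ⟨hz, hzp⟩)]
  have hdense : Dense Sᶜ := (hS.isLindelof.countable_of_isDiscrete hd).dense_compl ℝ
  have hEb : ∀ z, ‖E z‖ ≤ M := by
    intro z
    have hcl : IsClosed {z | ‖E z‖ ≤ M} := isClosed_le hEd.continuous.norm continuous_const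
    refine closure_minimal (fun w hw => ?_) hcl (hdense z)
    simpa [hE w hw] using hM w hw
  obtain ⟨b, hb⟩ := hEd.exists_const_forall_eq_of_bounded
    (isBounded_iff_forall_norm_le.2 ⟨M, by rintro _ ⟨z, rfl⟩; exact hEb z⟩)
  exact ⟨b, fun z hz => by rw [← hE z hz, hb]⟩

/-- The functional equation `X (z + 1) = G (X z)` persists under analytic continuation off a
countable closed set, at every point whose value is not a pole of `G`. -/
theorem functional_equation_continuation {S : Set ℂ} (hSc : S.Countable)
    {X G : ℂ → ℂ} (hX : AnalyticOnNhd ℂ X Sᶜ) (hG : ∀ z, MeromorphicAt G z) {z₀ : ℂ}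
    (h₀ : z₀ ∉ S) (h₁ : z₀ + 1 ∉ S) (heq : ∀ᶠ z in 𝓝 z₀, X (z + 1) = G (X z))
    {z : ℂ} (hz : z ∉ S) (hz1 : z + 1 ∉ S) (hGz : AnalyticAt ℂ G (X z)) :
    X (z + 1) = G (X z) := by
  -- Off the countable set `T` the plane is connected. `f` is only meromorphic there, since `X` may
  -- meet poles of `G`, so the identity theorem is applied to orders.
  let T : Set ℂ := S ∪ (· + 1) ⁻¹' S
  have hT : T.Countable := hSc.union (hSc.preimage (add_left_injective 1))
  have hconn : IsPreconnected Tᶜ :=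
    (hT.isConnected_compl_of_one_lt_rank (by simp)).isPreconnected
  have hshift : ∀ w, w + 1 ∉ S → AnalyticAt ℂ (fun w => X (w + 1)) w := fun w hw =>
    AnalyticAt.fun_comp (g := X) (f := fun w => w + 1) (hX _ hw) (by fun_prop)
  let f : ℂ → ℂ := fun w => X (w + 1) - G (X w)
  have hf : MeromorphicOn f Tᶜ := by
    intro w hw
    simp only [T, mem_compl_iff, mem_union, not_or] at hw
    exact (hshift w hw.2).meromorphicAt.sub ((hG _).comp_analyticAt (hX w hw.1))
  have htop : meromorphicOrderAt f z₀ = ⊤ := by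
    rw [meromorphicOrderAt_eq_top_iff]
    exact (heq.mono fun w hw => sub_eq_zero.2 hw).filter_mono nhdsWithin_le_nhds
  have hz' : meromorphicOrderAt f z = ⊤ := by
    by_contra hne
    exact hf.meromorphicOrderAt_ne_top_of_isPreconnected hconn (x := z) (y := z₀)
      (by simp [T, hz, hz1]) (by simp [T, h₀, h₁]) hne htop
  have hfz : AnalyticAt ℂ f z := (hshift z hz1).sub (hGz.fun_comp (hX z hz))
  rw [meromorphicOrderAt_eq_top_iff] at hz'
  exact sub_eq_zero.1 (hfz.frequently_zero_iff_eventually_zero.1 hz'.frequently).self_of_nhds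

lemma norm_exp_lt_iff {z L : ℂ} {r : ℝ} (hr : 0 < r) :
    ‖Complex.exp (z * L)‖ < r ↔ (z * L).re < Real.log r := by
  rw [Complex.norm_exp, Real.lt_log_iff_exp_lt hr]

/-- If `φ (exp (z L))`, where `φ` linearizes `G` at its attracting fixed point `0`, continues from
a half-plane to an analytic function off a closed discrete set, then `φ` is a Möbius map. -/
theorem linearization_moebius_of_continuation {a L : ℂ} {G φ X : ℂ → ℂ} {S : Set ℂ} {R : ℝ}
    (hL : Complex.exp L = a) (ha0 : 0 < ‖a‖) (ha1 : ‖a‖ < 1)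
    (hGm : ∀ z, MeromorphicAt G z) (hG : AnalyticAt ℂ G 0)
    (hφ : AnalyticAt ℂ φ 0) (hφ0 : φ 0 = 0) (hφ1 : deriv φ 0 = 1)
    (hconj : ∀ᶠ w in 𝓝 0, φ (a * w) = G (φ w))
    (hS : IsClosed S) (hd : IsDiscrete S) (hX : AnalyticOnNhd ℂ X Sᶜ)
    (hR : ∀ z : ℂ, (z * L).re < R → z ∉ S ∧ X z = φ (Complex.exp (z * L))) :
    ∃ b, ∀ᶠ w in 𝓝 0, φ w * (1 + b * w) = w := by
  have ha : a ≠ 0 := norm_pos_iff.1 ha0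
  have hL0 : L ≠ 0 := by
    rintro rfl
    rw [Complex.exp_zero] at hL
    simp [← hL] at ha1
  have hSc : S.Countable := hS.isLindelof.countable_of_isDiscrete hd
  have hne : deriv φ 0 ≠ 0 := by rw [hφ1]; exact one_ne_zero
  have hleft := hφ.hasStrictDerivAt.eventually_left_inverse hne
  have hmap : Filter.map φ (𝓝 0) = 𝓝 0 := by
    simpa [hφ0] using hφ.hasStrictDerivAt.map_nhds_eq hne
  have hquad : (fun w => φ w - w) =O[𝓝 0] fun w : ℂ => ‖w‖ ^ 2 := by
    refine isBigO_norm_sq_of_deriv_eq_zero (by fun_prop) (by simp [hφ0]) ?_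
    exact (hφ.differentiableAt.hasDerivAt.sub (hasDerivAt_id (0 : ℂ))).deriv.trans (by simp [hφ1])
  obtain ⟨K, hK0, hK⟩ := hquad.exists_pos
  have htφ : Tendsto φ (𝓝 0) (𝓝 0) := hmap.le
  obtain ⟨r₀, hr₀, hball⟩ := Metric.eventually_nhds_iff_ball.1
    (hK.bound.and (hleft.and (hconj.and (htφ.eventually hG.eventually_analyticAt))))
  -- `Real.exp R` keeps the disc inside the half-plane of continuation; `1 / (2 * K)` ensures `‖φ w‖
  -- ≥ ‖w‖ / 2`.
  obtain ⟨r₁, hr₁, hr₁0, hr₁R, hr₁K⟩ :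
      ∃ r₁, 0 < r₁ ∧ r₁ ≤ r₀ ∧ r₁ ≤ Real.exp R ∧ r₁ ≤ 1 / (2 * K) :=
    ⟨min r₀ (min (Real.exp R) (1 / (2 * K))), by positivity, min_le_left _ _,
      (min_le_right _ _).trans (min_le_left _ _), (min_le_right _ _).trans (min_le_right _ _)⟩
  replace hball : ∀ w : ℂ, ‖w‖ < r₁ → _ := fun w hw =>
    hball w (by simpa using hw.trans_le hr₁0)
  have hinj : ∀ w w' : ℂ, ‖w‖ < r₁ → ‖w'‖ < r₁ → φ w = φ w' → w = w' := fun w w' hw hw' h => by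
    rw [← (hball w hw).2.1, ← (hball w' hw').2.1, h]
  have hhalf : ∀ z : ℂ, ‖Complex.exp (z * L)‖ < r₁ → (z * L).re < R := fun z hz => by
    have h := hz.trans_le hr₁R
    rwa [Complex.norm_exp, Real.exp_lt_exp] at h
  have hexp : ∀ (z : ℂ) (n : ℕ),
      Complex.exp ((z + n) * L) = a ^ n * Complex.exp (z * L) := fun z n => by
    rw [add_mul, Complex.exp_add, Complex.exp_nat_mul, hL, mul_comm]
  have hlog : ∀ w : ℂ, w ≠ 0 → Complex.exp (Complex.log w / L * L) = w := fun w hw => by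
    rw [div_mul_cancel₀ _ hL0, Complex.exp_log hw]
  have hpow : ∀ (n : ℕ) (w : ℂ), ‖w‖ < r₁ → ‖a ^ n * w‖ < r₁ := fun n w hw => by
    rw [norm_mul, norm_pow]
    exact (mul_le_of_le_one_left (norm_nonneg w) (pow_le_one₀ ha0.le ha1.le)).trans_lt hw
  -- a base point where the functional equation holds
  obtain ⟨z₀, hz₀⟩ : ∃ z₀ : ℂ, ‖Complex.exp (z₀ * L)‖ < r₁ := by
    have h := hlog ((r₁ / 2 : ℝ) : ℂ) (by exact_mod_cast (half_pos hr₁).ne')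
    refine ⟨_, (congrArg norm h).trans_lt ?_⟩
    rw [Complex.norm_real, Real.norm_of_nonneg (half_pos hr₁).le]
    exact half_lt_self hr₁
  have hsmall : ∀ z : ℂ, ‖Complex.exp (z * L)‖ < r₁ →
      z ∉ S ∧ X z = φ (Complex.exp (z * L)) := fun z hz => hR z (hhalf z hz)
  have hsmall1 : ∀ z : ℂ, ‖Complex.exp (z * L)‖ < r₁ →
      z + 1 ∉ S ∧ X (z + 1) = φ (a * Complex.exp (z * L)) := fun z hz => by
    have h1 := hexp z 1
    have h2 := hpow 1 _ hz
    simp only [Nat.cast_one, pow_one] at h1 h2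
    rw [← h1] at h2 ⊢
    exact hsmall _ h2
  have heq : ∀ᶠ z in 𝓝 z₀, X (z + 1) = G (X z) := by
    have hc : ContinuousAt (fun z : ℂ => ‖Complex.exp (z * L)‖) z₀ := by fun_prop
    filter_upwards [hc.eventually (Iio_mem_nhds hz₀)] with z hz
    rw [(hsmall1 z hz).2, (hsmall z hz).2]
    exact (hball _ hz).2.2.1
  -- values of `X` near `0` are only taken in the half-plane
  have hback : ∀ z : ℂ, (∀ n : ℕ, z + n ∉ S) → ∀ w : ℂ, ‖w‖ < r₁ → X z = φ w →
      Complex.exp (z * L) = w := by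
    intro z hz w hw hzw
    have horbit : ∀ n : ℕ, X (z + n) = φ (a ^ n * w) := by
      intro n
      induction n with
      | zero => simpa using hzw
      | succ n ih =>
        have hb := hball _ (hpow n w hw)
        have hst := functional_equation_continuation hSc hX hGm (hsmall z₀ hz₀).1
          (hsmall1 z₀ hz₀).1 heq (hz n)
          (by simpa [add_assoc] using hz (n + 1)) (by rw [ih]; exact hb.2.2.2)
        rw [ih, ← hb.2.2.1] at hst
        rw [Nat.cast_add, Nat.cast_one, ← add_assoc, hst, pow_succ', mul_assoc]
    -- For large `n`, `X (z + n)` is both `φ (a^n w)` and `φ (a^n e^{zL})`, with both arguments in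
    -- the disc of injectivity.
    have hlim : Tendsto (fun n : ℕ => ‖a ^ n * Complex.exp (z * L)‖) atTop (𝓝 0) := by
      have h := (tendsto_pow_atTop_nhds_zero_of_norm_lt_one ha1).mul_const (Complex.exp (z * L))
      simpa using h.norm
    obtain ⟨n, hn⟩ := (hlim.eventually (Iio_mem_nhds hr₁)).exists
    have h1 := (hsmall (z + n) (by rw [hexp]; exact hn)).2
    rw [horbit, hexp] at h1
    exact (mul_left_cancel₀ (pow_ne_zero n ha) (hinj _ _ (hpow n w hw) hn h1)).symm
  obtain ⟨ε, hε, hεball⟩ : ∃ ε > 0, ball (0 : ℂ) ε ⊆ φ '' ball 0 (r₁ / 2) :=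
    Metric.mem_nhds_iff.1 (hmap ▸ image_mem_map (ball_mem_nhds 0 (half_pos hr₁)))
  have hfar : ∀ z ∉ S, r₁ / 2 < ‖Complex.exp (z * L)‖ → ε ≤ ‖X z‖ := by
    intro z hz hzr
    by_contra! hlt
    -- Some `z + n` may lie in `S`, so `z` is moved slightly to a `z'` whose forward translates all
    -- avoid `S`; both strict inequalities survive.
    let T : Set ℂ := ⋃ n : ℕ, (· + (n : ℂ)) ⁻¹' S
    have hT : Dense Tᶜ := (countable_iUnion fun n : ℕ =>
      hSc.preimage (add_left_injective (n : ℂ))).dense_compl ℝ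
    have hc : ContinuousAt (fun z : ℂ => ‖Complex.exp (z * L)‖) z := by fun_prop
    have hev := ((hX z hz).continuousAt.norm.eventually (Iio_mem_nhds hlt)).and
      (hc.eventually (Ioi_mem_nhds hzr))
    obtain ⟨z', h3, h1, h2⟩ := hT.inter_nhds_nonempty hev
    obtain ⟨w, hw, hwX⟩ := hεball (show X z' ∈ ball 0 ε by simpa using h1)
    have hw' : ‖w‖ < r₁ / 2 := by simpa using hw
    have h4 := hback z' (fun n hn => h3 (mem_iUnion.2 ⟨n, hn⟩)) w (by linarith) hwX.symm
    rw [← h4] at hw'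
    exact lt_asymm hw' h2
  have hnear : ∀ w : ℂ, w ≠ 0 → ‖w‖ < r₁ →
      φ w ≠ 0 ∧ ‖(φ w)⁻¹ - w⁻¹‖ ≤ 2 * K := by
    intro w hw0 hw
    have h1 : ‖φ w - w‖ ≤ K * ‖w‖ ^ 2 := by simpa using (hball w hw).1
    have hwp : 0 < ‖w‖ := norm_pos_iff.2 hw0
    have h2 : K * ‖w‖ ≤ 1 / 2 := by
      have h := mul_le_mul_of_nonneg_left (hw.le.trans hr₁K) hK0.le
      calc _ ≤ _ := h
        _ = 1 / 2 := by field_simp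
    have h3 : ‖w‖ / 2 ≤ ‖φ w‖ := by
      have h := norm_sub_norm_le w (φ w)
      rw [norm_sub_rev] at h
      nlinarith
    have h4 : φ w ≠ 0 := norm_pos_iff.1 ((half_pos hwp).trans_le h3)
    refine ⟨h4, ?_⟩
    rw [inv_sub_inv h4 hw0, norm_div, norm_mul, norm_sub_rev,
      div_le_iff₀ (mul_pos (norm_pos_iff.2 h4) hwp)]
    nlinarith [mul_le_mul_of_nonneg_left h3 (mul_pos hK0 hwp).le]
  have hXne : ∀ z ∉ S, X z ≠ 0 ∧
      ‖(X z)⁻¹ - (Complex.exp (z * L))⁻¹‖ ≤ ε⁻¹ + (r₁ / 2)⁻¹ + 2 * K := by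
    intro z hz
    rcases lt_or_ge (r₁ / 2) ‖Complex.exp (z * L)‖ with h | h
    · have h1 := hfar z hz h
      refine ⟨norm_pos_iff.1 (hε.trans_le h1), (norm_sub_le _ _).trans ?_⟩
      rw [norm_inv, norm_inv]
      have h2 := inv_anti₀ hε h1
      have h3 := inv_anti₀ (half_pos hr₁) h.le
      linarith
    · have h1 : ‖Complex.exp (z * L)‖ < r₁ := by linarith
      have h2 := hnear _ (Complex.exp_ne_zero _) h1
      rw [(hsmall z h1).2]
      have h3 : 0 < ε⁻¹ + (r₁ / 2)⁻¹ := by positivity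
      exact ⟨h2.1, by linarith [h2.2]⟩
  obtain ⟨b, hb⟩ := exists_eq_const_of_bounded_off_discrete hS hd
    (H := fun z => (X z)⁻¹ - (Complex.exp (z * L))⁻¹)
    (fun z hz => ((hX z hz).inv (hXne z hz).1).sub
      (AnalyticAt.inv (by fun_prop) (Complex.exp_ne_zero _)))
    fun z hz => (hXne z hz).2
  refine ⟨b, ?_⟩
  filter_upwards [ball_mem_nhds (0 : ℂ) hr₁] with w hw
  have hw' : ‖w‖ < r₁ := by simpa using hw
  rcases eq_or_ne w 0 with rfl | hw0
  · simp [hφ0]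
  have hexpw := hlog w hw0
  have h1 := hsmall (Complex.log w / L) (by rwa [hexpw])
  have h2 := hb _ h1.1
  have h3 := (hnear w hw0 hw').1
  simp only [h1.2, hexpw] at h2
  rw [← h2]
  field_simp
  ring

/-! ### From the linearization back to `G`. -/

/-- If the linearization of `G` at `0` is a Möbius map, so is `G`. -/
theorem eventually_moebius_of_linearization {a b : ℂ} {G φ : ℂ → ℂ}
    (hφ : AnalyticAt ℂ φ 0) (hφ0 : φ 0 = 0) (hφ1 : deriv φ 0 = 1)
    (hconj : ∀ᶠ w in 𝓝 0, φ (a * w) = G (φ w))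
    (hb : ∀ᶠ w in 𝓝 0, φ w * (1 + b * w) = w) :
    ∀ᶠ y in 𝓝 0, G y * (1 + b * (a - 1) * y) = a * y := by
  have hmap : Filter.map φ (𝓝 0) = 𝓝 0 := by
    simpa [hφ0] using hφ.hasStrictDerivAt.map_nhds_eq (by rw [hφ1]; exact one_ne_zero)
  -- With `y = φ w`, eliminating `w` from `1/y = 1/w + b` and `1/G y = 1/(a w) + b` gives `a/G y =
  -- 1/y + b (a - 1)`.
  rw [← hmap, eventually_map]
  have hta : Tendsto (fun w : ℂ => a * w) (𝓝 0) (𝓝 0) := by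
    simpa using (continuous_const_mul a).tendsto (0 : ℂ)
  have hne : ∀ᶠ w in 𝓝 (0 : ℂ), 1 + b * w ≠ 0 := by
    have hc : ContinuousAt (fun w : ℂ => 1 + b * w) 0 := by fun_prop
    exact hc.eventually_ne (by simp)
  filter_upwards [hconj, hb, hta.eventually hb, hne] with w h1 h2 h3 h4
  rw [h1] at h3
  refine mul_right_cancel₀ h4 ?_
  linear_combination h3 + (G (φ w) * b * (a - 1) - a) * h2

/-- Identity theorem: a meromorphic function in normal form that is the Möbius map
`a z / (1 + c z)` near `0` is that map everywhere. -/
theorem eq_moebius_of_eventually {a c : ℂ} {G : ℂ → ℂ} (hG : MeromorphicNFOn G univ)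
    (h : ∀ᶠ y in 𝓝 0, G y * (1 + c * y) = a * y) (z : ℂ) (hz : 1 + c * z ≠ 0) :
    G z = a * z / (1 + c * z) := by
  let f : ℂ → ℂ := fun y => G y * (1 + c * y) - a * y
  have hlin : ∀ y : ℂ, MeromorphicAt (fun y : ℂ => 1 + c * y) y := fun y =>
    (show AnalyticAt ℂ (fun y : ℂ => 1 + c * y) y by fun_prop).meromorphicAt
  have hf : MeromorphicOn f univ := fun y _ =>
    ((hG (mem_univ y)).meromorphicAt.mul (hlin y)).sub
      (show AnalyticAt ℂ (fun y : ℂ => a * y) y by fun_prop).meromorphicAt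
  have h0 : meromorphicOrderAt f 0 = ⊤ := by
    rw [meromorphicOrderAt_eq_top_iff]
    exact (h.mono fun y hy => sub_eq_zero.2 hy).filter_mono nhdsWithin_le_nhds
  have hz' : meromorphicOrderAt f z = ⊤ := by
    by_contra hne
    exact hf.meromorphicOrderAt_ne_top_of_isPreconnected isPreconnected_univ
      (mem_univ z) (mem_univ 0) hne h0
  rw [meromorphicOrderAt_eq_top_iff] at hz'
  have hc : ContinuousAt (fun y : ℂ => 1 + c * y) z := by fun_prop
  have hM : AnalyticAt ℂ (fun y : ℂ => a * y / (1 + c * y)) z :=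
    AnalyticAt.div (by fun_prop) (by fun_prop) hz
  -- Normal form upgrades equality near `z` to equality at `z`.
  refine (((hG (mem_univ z)).eventuallyEq_nhdsNE_iff_eventuallyEq_nhds hM.meromorphicNFAt).1
    ?_).eq_of_nhds
  filter_upwards [hz', (hc.eventually_ne hz).filter_mono nhdsWithin_le_nhds] with y h1 h2
  exact (eq_div_iff h2).2 (sub_eq_zero.1 h1)

/-! ### Transseries as power series in `C e^{zL}`; necessity. -/

lemma transTerm_eq (L : ℂ) (D : ℕ → ℂ) (C z : ℂ) (k : ℕ) :
    transTerm L D C z k = (C * Complex.exp (z * L)) ^ (k + 1) * D (k + 1) := by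
  rw [transTerm, mul_pow, ← Complex.exp_nat_mul, mul_comm (C ^ (k + 1))]
  congr 3
  ring

lemma embedding_eq_tsum (L : ℂ) (D : ℕ → ℂ) (C z : ℂ) :
    embedding L D C z = ∑' k : ℕ, (C * Complex.exp (z * L)) ^ (k + 1) * D (k + 1) :=
  tsum_congr (transTerm_eq L D C z)

lemma exp_natCast_mul_eq_pow {a L : ℂ} (hL : Complex.exp L = a) (n : ℕ) :
    Complex.exp (n * L) = a ^ n := by
  rw [Complex.exp_nat_mul, hL]

lemma tendsto_mul_pow_nhds_zero {a : ℂ} (ha1 : ‖a‖ < 1) (C : ℂ) :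
    Tendsto (fun n : ℕ => C * a ^ n) atTop (𝓝 0) := by
  simpa using (tendsto_pow_atTop_nhds_zero_of_norm_lt_one ha1).const_mul C

/-- The Taylor coefficients at `0` of a germ conjugating `w ↦ a w` to `G` give a solution family. -/
theorem exists_isSolutionFamily {a L : ℂ} {G φ : ℂ → ℂ} (hL : Complex.exp L = a)
    (ha1 : ‖a‖ < 1) (hφ : AnalyticAt ℂ φ 0) (hφ0 : φ 0 = 0)
    (hconj : ∀ᶠ w in 𝓝 0, φ (a * w) = G (φ w)) :
    ∃ D : ℕ → ℂ, IsSolutionFamily G L D ∧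
      ∀ᶠ w in 𝓝 0, HasSum (fun k : ℕ => w ^ (k + 1) * D (k + 1)) (φ w) := by
  obtain ⟨p, hp⟩ := hφ
  have hsum : ∀ᶠ w in 𝓝 0, HasSum (fun k : ℕ => w ^ (k + 1) * p.coeff (k + 1)) (φ w) := by
    filter_upwards [hasFPowerSeriesAt_iff.1 hp] with w hw
    have h0 : p.coeff 0 = 0 := (hp.coeff_zero _).trans hφ0
    rw [← hasSum_nat_add_iff' 1] at hw
    simpa [h0] using hw
  refine ⟨p.coeff, fun C => ?_, hsum⟩
  have ht := tendsto_mul_pow_nhds_zero ha1 C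
  filter_upwards [ht.eventually hsum, (tendsto_add_atTop_iff_nat 1).2 ht |>.eventually hsum,
    ht.eventually hconj] with n h1 h2 h3
  have e1 := exp_natCast_mul_eq_pow hL n
  have e2 := exp_natCast_mul_eq_pow hL (n + 1)
  refine ⟨h1.summable.congr fun k => by rw [transTerm_eq, e1], ?_⟩
  rw [embedding_eq_tsum, embedding_eq_tsum, e1, e2, h1.tsum_eq, h2.tsum_eq, ← h3, pow_succ']
  congr 1
  ring

/-- The IMSP forces a linear fractional map. -/
theorem eq_moebius_of_hasIMSP {a L : ℂ} {G : ℂ → ℂ} (hGm : MeromorphicNFOn G univ)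
    (hG : AnalyticAt ℂ G 0) (hG0 : G 0 = 0) (hG1 : deriv G 0 = a)
    (ha0 : 0 < ‖a‖) (ha1 : ‖a‖ < 1) (hL : Complex.exp L = a) (hI : HasIMSP G L) :
    ∃ c : ℂ, ∀ z : ℂ, 1 + c * z ≠ 0 → G z = a * z / (1 + c * z) := by
  obtain ⟨φ, hφ, hφ0, hφ1, hconj⟩ := exists_linearization hG hG0 hG1 ha0 ha1
  obtain ⟨D, hD, hsum⟩ := exists_isSolutionFamily hL ha1 hφ hφ0 hconj
  obtain ⟨S, hS, hd, X, hX, R, hR⟩ := hI D hD 1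
  obtain ⟨δ, hδ, hball⟩ := Metric.eventually_nhds_iff_ball.1 hsum
  obtain ⟨b, hb⟩ := linearization_moebius_of_continuation (R := min R (Real.log δ)) hL ha0 ha1
    (fun z => (hGm (mem_univ z)).meromorphicAt) hG hφ hφ0 hφ1 hconj hS hd hX fun z hz => by
      have h1 := hR z (hz.trans_le (min_le_left _ _))
      have h2 := (norm_exp_lt_iff hδ).2 (hz.trans_le (min_le_right _ _))
      refine ⟨h1.1, h1.2.trans ?_⟩
      rw [embedding_eq_tsum, one_mul]
      exact (hball _ (by simpa using h2)).tsum_eq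
  exact ⟨_, eq_moebius_of_eventually hGm
    (eventually_moebius_of_linearization hφ hφ0 hφ1 hconj hb)⟩

/-! ### Sufficiency: the Möbius case. -/

/-- A power series without constant term that converges somewhere off `0` is analytic at `0`. -/
lemma analyticAt_tsum_pow_succ {D : ℕ → ℂ} {w₀ : ℂ} (hw₀ : w₀ ≠ 0)
    (hs : Summable fun k : ℕ => w₀ ^ (k + 1) * D (k + 1)) :
    AnalyticAt ℂ (fun w : ℂ => ∑' k : ℕ, w ^ (k + 1) * D (k + 1)) 0 := by
  have hp : 0 < ‖w₀‖ := norm_pos_iff.2 hw₀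
  obtain ⟨B, hB⟩ := hs.tendsto_atTop_zero.norm.bddAbove_range
  have hgeo : Summable fun k : ℕ => B * (1 / 2 : ℝ) ^ (k + 1) :=
    ((summable_nat_add_iff 1).2 summable_geometric_two).mul_left B
  refine (Complex.differentiableOn_tsum_of_summable_norm hgeo (U := ball 0 (‖w₀‖ / 2))
    (fun k => by fun_prop) isOpen_ball fun k w hw => ?_).analyticAt
    (ball_mem_nhds 0 (half_pos hp))
  have hw' : ‖w‖ ≤ ‖w₀‖ * (1 / 2) := by
    have : ‖w‖ < ‖w₀‖ / 2 := by simpa using hw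
    linarith
  have h1 : ‖w₀‖ ^ (k + 1) * ‖D (k + 1)‖ ≤ B := by
    rw [← norm_pow, ← norm_mul]
    exact hB ⟨k, rfl⟩
  rw [norm_mul, norm_pow]
  calc _ ≤ (‖w₀‖ * (1 / 2)) ^ (k + 1) * ‖D (k + 1)‖ := by gcongr
    _ = ‖w₀‖ ^ (k + 1) * ‖D (k + 1)‖ * (1 / 2) ^ (k + 1) := by rw [mul_pow]; ring
    _ ≤ _ := by gcongr

/-- A germ commuting with multiplication by `a`, `0 < ‖a‖ < 1`, is linear. -/
lemma eventually_eq_mul_of_comp_mul {a : ℂ} {u : ℂ → ℂ} (ha0 : 0 < ‖a‖) (ha1 : ‖a‖ < 1)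
    (hu : DifferentiableAt ℂ u 0) (hu0 : u 0 = 0) (h : ∀ᶠ w in 𝓝 0, u (a * w) = a * u w) :
    ∀ᶠ w in 𝓝 0, u w = deriv u 0 * w := by
  have ha : a ≠ 0 := norm_pos_iff.1 ha0
  obtain ⟨δ, hδ, hball⟩ := Metric.eventually_nhds_iff_ball.1 h
  filter_upwards [ball_mem_nhds (0 : ℂ) hδ] with w hw
  rcases eq_or_ne w 0 with rfl | hw0
  · simp [hu0]
  have hstep : ∀ n : ℕ, u (w * a ^ n) = a ^ n * u w := by
    intro n
    induction n with
    | zero => simp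
    | succ n ih =>
      have hn : w * a ^ n ∈ ball (0 : ℂ) δ := by
        rw [mem_ball_zero_iff] at hw ⊢
        rw [norm_mul, norm_pow]
        exact (mul_le_of_le_one_right (norm_nonneg w) (pow_le_one₀ ha0.le ha1.le)).trans_lt hw
      rw [pow_succ', show w * (a * a ^ n) = a * (w * a ^ n) by ring, hball _ hn, ih, mul_assoc]
  have ht : Tendsto (fun n : ℕ => w * a ^ n) atTop (𝓝[≠] 0) :=
    tendsto_nhdsWithin_iff.2 ⟨tendsto_mul_pow_nhds_zero ha1 w,
      Eventually.of_forall fun n => mul_ne_zero hw0 (pow_ne_zero n ha)⟩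
  have hlim := (hasDerivAt_iff_tendsto_slope.1 hu.hasDerivAt).comp ht
  -- The slope of `u` between `0` and `w a^n` does not depend on `n`, so it equals its limit `deriv
  -- u 0`.
  have hconst : ∀ n : ℕ, (slope u 0 ∘ fun n : ℕ => w * a ^ n) n = u w / w := by
    intro n
    have := pow_ne_zero n ha
    simp only [Function.comp_apply, slope_def_field, hu0, hstep, sub_zero]
    field_simp
  rw [tendsto_congr hconst] at hlim
  rw [tendsto_nhds_unique hlim tendsto_const_nhds |>.trans rfl]
  field_simp

/-- Germs conjugating `w ↦ a w` to `a z / (1 + c z)` are linear fractional. -/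
theorem eventually_moebius_of_conj {a c : ℂ} {G φ : ℂ → ℂ} (ha0 : 0 < ‖a‖) (ha1 : ‖a‖ < 1)
    (hG : ∀ z : ℂ, 1 + c * z ≠ 0 → G z = a * z / (1 + c * z))
    (hφ : AnalyticAt ℂ φ 0) (hφ0 : φ 0 = 0) (hconj : ∀ᶠ w in 𝓝 0, φ (a * w) = G (φ w)) :
    ∃ l m : ℂ, ∀ᶠ w in 𝓝 0, φ w = l * w / (1 - m * w) := by
  have ha : 1 - a ≠ 0 := by
    intro h
    rw [← sub_eq_zero.1 h] at ha1
    simp at ha1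
  -- This `β` makes `1 + β G y = (1 + β y) / (1 + c y)`, so `y / (1 + β y)` linearizes `G`.
  obtain ⟨β, hβ⟩ : ∃ β, β = c + β * a := ⟨c / (1 - a), by field_simp; ring⟩
  have htφ : Tendsto φ (𝓝 0) (𝓝 0) := by simpa [hφ0] using hφ.continuousAt.tendsto
  have hta : Tendsto (fun w : ℂ => a * w) (𝓝 0) (𝓝 0) := by
    simpa using (continuous_const_mul a).tendsto (0 : ℂ)
  have hne : ∀ γ : ℂ, ∀ᶠ w in 𝓝 (0 : ℂ), 1 + γ * w ≠ 0 := fun γ => by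
    have hc : ContinuousAt (fun w : ℂ => 1 + γ * w) 0 := by fun_prop
    exact hc.eventually_ne (by simp)
  let u : ℂ → ℂ := fun w => φ w / (1 + β * φ w)
  have hu : AnalyticAt ℂ u 0 :=
    hφ.div (by fun_prop) (by simp [hφ0])
  have hu0 : u 0 = 0 := by simp [u, hφ0]
  have hlin := eventually_eq_mul_of_comp_mul ha0 ha1 hu.differentiableAt hu0 (by
    filter_upwards [hconj, htφ.eventually (hne c), htφ.eventually (hne β),
      (htφ.comp hta).eventually (hne β)] with w h1 h2 h3 h4
    simp only [Function.comp_apply, h1, hG _ h2] at h4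
    simp only [u, h1, hG _ h2]
    have h2' : 1 + φ w * c ≠ 0 := by rwa [mul_comm]
    have h3' : 1 + φ w * β ≠ 0 := by rwa [mul_comm]
    have h5 : 1 + β * (a * φ w / (1 + c * φ w)) = (1 + β * φ w) / (1 + c * φ w) := by
      field_simp
      linear_combination -φ w * hβ
    rw [h5]
    field_simp)
  refine ⟨deriv u 0, β * deriv u 0, ?_⟩
  filter_upwards [hlin, htφ.eventually (hne β), hne (-(β * deriv u 0))] with w h1 h2 h3
  rw [neg_mul, ← sub_eq_add_neg] at h3
  rw [eq_div_iff h3]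
  have h4 : φ w = deriv u 0 * w * (1 + β * φ w) := (div_eq_iff h2).1 h1
  linear_combination h4

/-- A germ `l w / (1 - m w)` yields an embedding whose singularities are isolated poles. -/
theorem onlyIsolatedSingularities_of_moebius {L : ℂ} {D : ℕ → ℂ} {l m : ℂ}
    (hL : Complex.exp L ≠ 1)
    (h : ∀ᶠ w in 𝓝 0, ∑' k : ℕ, w ^ (k + 1) * D (k + 1) = l * w / (1 - m * w)) (C : ℂ) :
    OnlyIsolatedSingularities L (embedding L D C) := by
  let g : ℂ → ℂ := fun z => 1 - m * (C * Complex.exp (z * L))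
  have hg : AnalyticOnNhd ℂ g univ := fun z _ => by fun_prop
  obtain ⟨z₀, hz₀⟩ : ∃ z, g z ≠ 0 := by
    by_contra! hall
    have h0 : m * C = 1 := by
      have h := hall 0
      simp only [g, zero_mul, Complex.exp_zero, mul_one] at h
      exact (sub_eq_zero.1 h).symm
    have h1 := hall 1
    simp only [g, one_mul, ← mul_assoc, h0] at h1
    exact hL (sub_eq_zero.1 h1).symm
  have hcod := hg.preimage_zero_mem_codiscrete hz₀
  rw [show g ⁻¹' {0}ᶜ = {z | g z = 0}ᶜ from rfl, compl_mem_codiscrete_iff] at hcod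
  have hne : ∀ᶠ w in 𝓝 (0 : ℂ), 1 - m * w ≠ 0 := by
    have hc : ContinuousAt (fun w : ℂ => 1 - m * w) 0 := by fun_prop
    exact hc.eventually_ne (by simp)
  obtain ⟨δ, hδ, hball⟩ := Metric.eventually_nhds_iff_ball.1 (h.and hne)
  refine ⟨{z | g z = 0}, hcod.1, hcod.2, fun z => l * (C * Complex.exp (z * L)) / g z,
    fun z hz => AnalyticAt.div (by fun_prop) (hg z (mem_univ z)) hz,
    -- The `+ 1` covers `C = 0`.
    Real.log (δ / (‖C‖ + 1)), fun z hz => ?_⟩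
  have hC : 0 < ‖C‖ + 1 := by positivity
  have h1 := (norm_exp_lt_iff (div_pos hδ hC)).2 hz
  have h2 : ‖C * Complex.exp (z * L)‖ < δ := by
    rw [lt_div_iff₀ hC] at h1
    rw [norm_mul]
    nlinarith [norm_nonneg C, norm_nonneg (Complex.exp (z * L))]
  have h3 := hball _ (show C * Complex.exp (z * L) ∈ ball 0 δ by simpa using h2)
  exact ⟨h3.2, by rw [embedding_eq_tsum, h3.1]⟩

/-- The map `a z / (1 + c z)` has the IMSP. -/
theorem hasIMSP_of_moebius {a L c : ℂ} {G : ℂ → ℂ} (hGa : AnalyticAt ℂ G 0)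
    (ha0 : 0 < ‖a‖) (ha1 : ‖a‖ < 1) (hL : Complex.exp L = a)
    (hG : ∀ z : ℂ, 1 + c * z ≠ 0 → G z = a * z / (1 + c * z)) : HasIMSP G L := by
  intro D hD C
  have ha : a ≠ 0 := norm_pos_iff.1 ha0
  let φ : ℂ → ℂ := fun w => ∑' k : ℕ, w ^ (k + 1) * D (k + 1)
  have hφ0 : φ 0 = 0 := by simp [φ]
  have hemb : ∀ n : ℕ, embedding L D 1 n = φ (a ^ n) := fun n => by
    rw [embedding_eq_tsum, one_mul, exp_natCast_mul_eq_pow hL]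
  have hφ : AnalyticAt ℂ φ 0 := by
    obtain ⟨n, hn, -⟩ := (hD 1).exists
    refine analyticAt_tsum_pow_succ (pow_ne_zero n ha) (hn.congr fun k => ?_)
    rw [transTerm_eq, one_mul, exp_natCast_mul_eq_pow hL]
  have hconj : ∀ᶠ w in 𝓝 0, φ (a * w) = G (φ w) := by
    have h1 : AnalyticAt ℂ (fun w => φ (a * w)) 0 :=
      AnalyticAt.fun_comp (g := φ) (f := fun w => a * w) (by simpa using hφ) (by fun_prop)
    have h2 : AnalyticAt ℂ (fun w => G (φ w)) 0 :=
      AnalyticAt.fun_comp (g := G) (f := φ) (by simpa [hφ0] using hGa) hφ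
    -- The recurrence with `C = 1` gives the conjugacy only at `w = a^n`; these points accumulate at
    -- `0`.
    refine (h1.frequently_eq_iff_eventually_eq h2).1 ?_
    have ht : Tendsto (fun n : ℕ => a ^ n) atTop (𝓝[≠] 0) :=
      tendsto_nhdsWithin_iff.2 ⟨tendsto_pow_atTop_nhds_zero_of_norm_lt_one ha1,
        Eventually.of_forall fun n => pow_ne_zero n ha⟩
    refine ht.frequently (Eventually.frequently ?_)
    filter_upwards [hD 1] with n hn
    rw [← pow_succ', ← hemb, ← hemb]
    exact hn.2
  obtain ⟨l, m, hlm⟩ := eventually_moebius_of_conj ha0 ha1 hG hφ hφ0 hconj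
  refine onlyIsolatedSingularities_of_moebius ?_ hlm C
  rintro h
  rw [hL] at h
  simp [h] at ha1

/-! ### Explicit orbits. -/

/-- The orbits of `a z / (1 + c z)`, in the coordinate `1 / x`, are explicit. -/
theorem orbit_moebius_iff {a c : ℂ} {G : ℂ → ℂ} (ha : a ≠ 0) (ha1 : a ≠ 1)
    (hG : ∀ z : ℂ, 1 + c * z ≠ 0 → G z = a * z / (1 + c * z))
    (x : ℕ → ℂ) (N : ℕ∞) (hx : x 0 ≠ 0) :
    (∀ n : ℕ, (n : ℕ∞) < N → 1 + c * x n ≠ 0 ∧ x (n + 1) = G (x n)) ↔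
      ∃ C : ℂ, ∀ n : ℕ, (n : ℕ∞) ≤ N → x n ≠ 0 ∧
        1 / x n = a ^ (-(n : ℤ)) * (C - c / (a - 1)) + c / (a - 1) := by
  have ha' : a - 1 ≠ 0 := sub_ne_zero.2 ha1
  -- In `s = 1/x` the map is `s ↦ (s + c) / a`, with fixed point `q`.
  obtain ⟨q, hq⟩ : ∃ q, q = c / (a - 1) := ⟨_, rfl⟩
  have hqc : q * a = q + c := by rw [hq]; field_simp; ring
  simp only [← hq]
  have hsucc : ∀ (n : ℕ) (C : ℂ), a * (a ^ (-((n + 1 : ℕ) : ℤ)) * (C - q) + q) =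
      a ^ (-(n : ℤ)) * (C - q) + q + c := fun n C => by
    have h : a ^ (-(n : ℤ)) = a * a ^ (-((n + 1 : ℕ) : ℤ)) := by
      rw [← zpow_one_add₀ ha]; congr 1; push_cast; ring
    rw [h]
    linear_combination hqc
  constructor
  · intro h
    refine ⟨1 / x 0, fun n => ?_⟩
    induction n with
    | zero => intro _; simp [hx]
    | succ n ih =>
      intro hn
      have hlt : (n : ℕ∞) < N := lt_of_lt_of_le (by exact_mod_cast n.lt_succ_self) hn
      obtain ⟨h1, h2⟩ := ih hlt.le
      obtain ⟨h3, h4⟩ := h n hlt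
      rw [hG _ h3] at h4
      refine ⟨by rw [h4]; exact div_ne_zero (mul_ne_zero ha h1) h3, mul_left_cancel₀ ha ?_⟩
      rw [hsucc, ← h2, h4]
      field_simp
  · rintro ⟨C, hC⟩ n hn
    obtain ⟨h1, h2⟩ := hC n hn.le
    obtain ⟨h3, h4⟩ := hC (n + 1) (by
      have := Order.add_one_le_of_lt hn
      exact_mod_cast this)
    have h5 : a * (1 / x (n + 1)) = 1 / x n + c := by rw [h4, h2, hsucc]
    field_simp at h5
    -- Otherwise `a / x (n + 1) = (1 + c x n) / x n` would vanish.
    have h6 : 1 + c * x n ≠ 0 := by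
      intro h0
      rw [show x n * c = c * x n by ring] at h5
      rw [h0, mul_zero] at h5
      exact mul_ne_zero ha h1 h5
    refine ⟨h6, ?_⟩
    rw [hG _ h6, eq_div_iff h6]
    linear_combination -h5

end DifferenceIMSP

/-- `G = a z + F(z)` is meromorphic in the plane, in normal form (analytic wherever it does not have
a pole, with the conventional value `0` at a pole). `L` is any fixed determination of `ln a`.
The second part treats orbits `x_0, …, x_N` (with `N = ⊤` for infinite ones) of finite points that
do not hit the pole of `G` before the time `N`. -/
theorem theorem3p2 (a L : ℂ) (G F : ℂ → ℂ)
    (hG : MeromorphicNFOn G Set.univ)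
    (hGF : ∀ z, G z = a * z + F z)
    (hF : AnalyticAt ℂ F 0) (hF0 : F 0 = 0) (hF1 : deriv F 0 = 0)
    (ha0 : 0 < ‖a‖) (ha1 : ‖a‖ < 1) (hL : Complex.exp L = a) :
    (DifferenceIMSP.HasIMSP G L ↔
      ∃ c : ℂ, ∀ z : ℂ, 1 + c * z ≠ 0 → G z = a * z / (1 + c * z)) ∧
    (∀ c : ℂ, (∀ z : ℂ, 1 + c * z ≠ 0 → G z = a * z / (1 + c * z)) →
      ∀ (x : ℕ → ℂ) (N : ℕ∞), x 0 ≠ 0 →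
        ((∀ n : ℕ, (n : ℕ∞) < N → 1 + c * x n ≠ 0 ∧ x (n + 1) = G (x n)) ↔
          ∃ C : ℂ, ∀ n : ℕ, (n : ℕ∞) ≤ N → x n ≠ 0 ∧
            1 / x n = a ^ (-(n : ℤ)) * (C - c / (a - 1)) + c / (a - 1))) := by
  have hG0 : G 0 = 0 := by simp [hGF, hF0]
  have hGeq : G = fun z => a * z + F z := funext hGF
  have hGa : AnalyticAt ℂ G 0 := by rw [hGeq]; fun_prop
  have hG1 : deriv G 0 = a := by
    rw [hGeq]
    exact (((hasDerivAt_id (0 : ℂ)).const_mul a).add hF.differentiableAt.hasDerivAt).deriv.trans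
      (by simp [hF1])
  refine ⟨⟨DifferenceIMSP.eq_moebius_of_hasIMSP hG hGa hG0 hG1 ha0 ha1 hL, ?_⟩, ?_⟩
  · rintro ⟨c, hc⟩
    exact DifferenceIMSP.hasIMSP_of_moebius hGa ha0 ha1 hL hc
  · intro c hc x N hx
    exact DifferenceIMSP.orbit_moebius_iff (norm_pos_iff.1 ha0)
      (by rintro rfl; simp at ha1) hc x N hx
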